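/- Let $R$ be a convex quadrilateral in the Euclidean plane, that is, a four-sided polygon such that for each side the other two vertices lie strictly on the same side of the line through it. An ellipse (circles included, degenerate ellipses excluded) is said to be inscribed in $R$ if it lies inside $R$ (that is, in the closed region bounded by $R$) and is tangent to each of the four sides of $R$. Then there is exactly one ellipse of maximal area among all ellipses inscribed in $R$, and there is no ellipse of minimal area among all ellipses inscribed in $R$. -/

import Mathlib

/-- The Euclidean `xy`-plane. -/
abbrev Plane : Type := EuclideanSpace ℝ (Fin 2)

/-- A quadrilateral (with vertices listed in cyclic order) is a convex four-sided polygon if, for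
each side, the two vertices not on that side lie strictly on the same side of the line through
that side. -/
def IsConvexQuadrilateral (R : Polygon Plane 4) : Prop :=
  ∀ i : Fin 4, (line[ℝ, R i, R (i + 1)]).SSameSide (R (i + 2)) (R (i + 3))

/-- The closed region bounded by a convex polygon. -/
def polygonRegion {n : ℕ} (R : Polygon Plane n) : Set Plane :=
  convexHull ℝ (Set.range R.vertices)

/-- A (nondegenerate) ellipse, as a curve in the plane: the image of the unit circle under an
invertible affine map. Circles are included. -/
def IsEllipse (E : Set Plane) : Prop :=
  ∃ f : Plane ≃ᵃ[ℝ] Plane, E = f '' Metric.sphere (0 : Plane) 1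

/-- The ellipse `E` is tangent to the `i`-th side of `R`: the line through that side meets `E` in
exactly one point, and this point belongs to the side. -/
def IsTangentToSide (E : Set Plane) (R : Polygon Plane 4) (i : Fin 4) : Prop :=
  ∃ p ∈ R.edgeSet ℝ i, E ∩ (line[ℝ, R i, R (i + 1)] : Set Plane) = {p}

/-- `E` is an ellipse inscribed in `R`: it lies inside `R` and is tangent to each side of `R`. -/
structure IsInscribedEllipse (E : Set Plane) (R : Polygon Plane 4) : Prop where
  isEllipse : IsEllipse E
  subset_region : E ⊆ polygonRegion R
  tangent : ∀ i : Fin 4, IsTangentToSide E R i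

/-- The area enclosed by an ellipse: the Lebesgue measure of its convex hull, which is the
curve together with the region that it bounds. -/
noncomputable def ellipseArea (E : Set Plane) : ENNReal :=
  MeasureTheory.volume (convexHull ℝ E)

/-! Tangency and inclusion are affine invariant, and an affine map multiplies all areas by the same
factor. So `IsConvexQuadrilateral.exists_eq_mapPolygon` reduces the problem to vertices `(0, 0)`,
`(1, 0)`, `(p, q)`, `(0, 1)` with `p, q > 0` and `p + q > 1`. An ellipse `C + A(S¹)` enters only
through its center `C` and the matrix `A * Aᵀ`, and it is inscribed iff each side satisfies one
support-function equation and one sign condition (`isInscribedEllipse_image_iff`). For the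
normalized quadrilateral the equations leave a single parameter `t`, in which the center is affine:
it runs along the open segment between the midpoints of the diagonals. The sign conditions and
nondegeneracy give `t ∈ (0, 1)` (`exists_param_of_touchesLine`). The area is a constant times the
square root of `stdDet`, a product of three affine functions of `t` that are positive on `(0, 1)`.
It vanishes at both ends, so a maximum exists and a minimum does not; strict log-concavity
(`stdDet_mul_stdDet_lt`) makes the maximum unique. -/

open MeasureTheory

/-! ### Signed areas and lines -/

/-- Twice the signed area of the triangle `P Q X`. -/
def cross (P Q X : Plane) : ℝ :=
  (Q 0 - P 0) * (X 1 - P 1) - (Q 1 - P 1) * (X 0 - P 0)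

theorem plane_ext {x y : Plane} (h0 : x 0 = y 0) (h1 : x 1 = y 1) : x = y := by
  ext i
  fin_cases i
  · exact h0
  · exact h1

theorem lineMap_coord (P Q : Plane) (s : ℝ) (i : Fin 2) :
    AffineMap.lineMap P Q s i = P i + s * (Q i - P i) := by
  simp [AffineMap.lineMap_apply]
  ring

theorem cross_lineMap (P Q X Y : Plane) (s : ℝ) :
    cross P Q (AffineMap.lineMap X Y s) = (1 - s) * cross P Q X + s * cross P Q Y := by
  simp only [cross, lineMap_coord]
  ring

theorem cross_self_left (P Q : Plane) : cross P Q P = 0 := by simp [cross]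

theorem cross_self_right (P Q : Plane) : cross P Q Q = 0 := by
  simp only [cross]
  ring

theorem cross_eq_zero_of_mem_line {P Q X : Plane} (h : X ∈ line[ℝ, P, Q]) :
    cross P Q X = 0 := by
  obtain ⟨s, rfl⟩ := (mem_affineSpan_pair_iff_exists_lineMap_eq).1 h
  rw [cross_lineMap, cross_self_left, cross_self_right]
  ring

theorem mem_line_iff {P Q X : Plane} (hPQ : P ≠ Q) :
    X ∈ line[ℝ, P, Q] ↔ cross P Q X = 0 := by
  refine ⟨cross_eq_zero_of_mem_line, fun h => ?_⟩
  have hd : (Q 0 - P 0) ^ 2 + (Q 1 - P 1) ^ 2 ≠ 0 := by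
    intro h0
    apply hPQ
    apply plane_ext <;> nlinarith [sq_nonneg (Q 0 - P 0), sq_nonneg (Q 1 - P 1)]
  unfold cross at h
  rw [mem_affineSpan_pair_iff_exists_lineMap_eq]
  refine ⟨((X 0 - P 0) * (Q 0 - P 0) + (X 1 - P 1) * (Q 1 - P 1)) /
    ((Q 0 - P 0) ^ 2 + (Q 1 - P 1) ^ 2), ?_⟩
  apply plane_ext
  · rw [lineMap_coord]
    field_simp
    linear_combination (Q 1 - P 1) * h
  · rw [lineMap_coord]
    field_simp
    linear_combination -(Q 0 - P 0) * h

/-- The product is used because the orientation of the quadrilateral is not known. -/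
theorem cross_mul_cross_pos {P Q X Y : Plane} (hPQ : P ≠ Q)
    (h : (line[ℝ, P, Q]).SSameSide X Y) : 0 < cross P Q X * cross P Q Y := by
  obtain ⟨⟨p₁, hp₁, p₂, hp₂, hr⟩, hX, hY⟩ := h
  rw [mem_line_iff hPQ] at hX hY hp₁ hp₂
  obtain ⟨r₁, r₂, hr₁, hr₂, hr⟩ : ∃ r₁ r₂ : ℝ, 0 < r₁ ∧ 0 < r₂ ∧
      r₁ • (X -ᵥ p₁) = r₂ • (Y -ᵥ p₂) := by
    apply hr.exists_pos
    · rintro h0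
      rw [vsub_eq_zero_iff_eq] at h0
      exact hX (h0 ▸ hp₁)
    · rintro h0
      rw [vsub_eq_zero_iff_eq] at h0
      exact hY (h0 ▸ hp₂)
  have e0 : r₁ * (X 0 - p₁ 0) = r₂ * (Y 0 - p₂ 0) := by simpa using congrArg (fun v : Plane => v 0) hr
  have e1 : r₁ * (X 1 - p₁ 1) = r₂ * (Y 1 - p₂ 1) := by simpa using congrArg (fun v : Plane => v 1) hr
  have key : r₁ * cross P Q X = r₂ * cross P Q Y := by
    unfold cross at *
    linear_combination (Q 0 - P 0) * e1 - (Q 1 - P 1) * e0 + r₁ * hp₁ - r₂ * hp₂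
  have : 0 < r₂ * (cross P Q X * cross P Q Y) := by
    have : r₂ * (cross P Q X * cross P Q Y) = r₁ * (cross P Q X) ^ 2 := by
      linear_combination - cross P Q X * key
    rw [this]
    positivity
  exact pos_of_mul_pos_right this hr₂.le

/-! ### Affine maps in coordinates and their effect on area -/

/-- `f` has linear part `!![a, b; c, d]` and translation part `(h, k)`. -/
def HasCoords (f : Plane → Plane) (a b c d h k : ℝ) : Prop :=
  ∀ v, f v 0 = a * v 0 + b * v 1 + h ∧ f v 1 = c * v 0 + d * v 1 + k

theorem exists_hasCoords (f : Plane ≃ᵃ[ℝ] Plane) :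
    ∃ a b c d h k, HasCoords f a b c d h k := by
  refine ⟨f.linear !₂[1, 0] 0, f.linear !₂[0, 1] 0, f.linear !₂[1, 0] 1, f.linear !₂[0, 1] 1,
    f 0 0, f 0 1, fun v => ?_⟩
  have hf : f v = f.linear v + f 0 := by simpa using f.map_vadd 0 v
  have hv : v = v 0 • !₂[1, 0] + v 1 • !₂[0, 1] := by apply plane_ext <;> simp
  have hl : f.linear v = v 0 • f.linear !₂[1, 0] + v 1 • f.linear !₂[0, 1] := by
    conv_lhs => rw [hv, map_add, map_smul, map_smul]
  rw [hf, hl]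
  constructor <;> simp <;> ring

theorem HasCoords.det {f : Plane ≃ᵃ[ℝ] Plane} {a b c d h k : ℝ} (hf : HasCoords f a b c d h k) :
    LinearMap.det (f.linear : Plane →ₗ[ℝ] Plane) = a * d - b * c := by
  have hl : ∀ v, f.linear v = f v - f 0 := fun v => by
    have := f.map_vadd 0 v
    simp only [vadd_eq_add, add_zero] at this
    rw [this, add_sub_cancel_right]
  rw [← LinearMap.det_toMatrix (EuclideanSpace.basisFun (Fin 2) ℝ).toBasis, Matrix.det_fin_two]
  simp [LinearMap.toMatrix_apply, hl, (hf _).1, (hf _).2]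

theorem HasCoords.det_ne_zero {f : Plane ≃ᵃ[ℝ] Plane} {a b c d h k : ℝ}
    (hf : HasCoords f a b c d h k) : a * d - b * c ≠ 0 := by
  rw [← hf.det]
  exact (LinearEquiv.isUnit_det' f.linear).ne_zero

theorem exists_affineEquiv_hasCoords {a b c d : ℝ} (h k : ℝ) (hdet : a * d - b * c ≠ 0) :
    ∃ f : Plane ≃ᵃ[ℝ] Plane, HasCoords f a b c d h k := by
  obtain ⟨D, hD⟩ : ∃ D, D = a * d - b * c := ⟨_, rfl⟩
  rw [← hD] at hdet
  let L : Plane ≃ₗ[ℝ] Plane :=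
    { toFun := fun v => !₂[a * v 0 + b * v 1, c * v 0 + d * v 1]
      invFun := fun v => !₂[(d * v 0 - b * v 1) / D, (a * v 1 - c * v 0) / D]
      map_add' := fun v w => by apply plane_ext <;> simp <;> ring
      map_smul' := fun r v => by apply plane_ext <;> simp <;> ring
      left_inv := fun v => by
        apply plane_ext
        · simp
          field_simp
          linear_combination -v 0 * hD
        · simp
          field_simp
          linear_combination -v 1 * hD
      right_inv := fun v => by
        apply plane_ext
        · simp
          field_simp
          linear_combination -v 0 * hD
        · simp
          field_simp
          linear_combination -v 1 * hD }
  refine ⟨L.toAffineEquiv.trans (AffineEquiv.constVAdd ℝ Plane !₂[h, k]), fun v => ?_⟩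
  constructor <;> simp [L] <;> ring

theorem volume_image_affineEquiv (f : Plane ≃ᵃ[ℝ] Plane) (s : Set Plane) :
    volume (f '' s) =
      ENNReal.ofReal |LinearMap.det (f.linear : Plane →ₗ[ℝ] Plane)| * volume s := by
  have : (f : Plane → Plane) = (fun x => f 0 + x) ∘ (f.linear : Plane →ₗ[ℝ] Plane) := by
    ext1 v
    have : f v = f.linear v + f 0 := by simpa using f.map_vadd 0 v
    simp [this, add_comm]
  rw [this, Set.image_comp, Set.image_add_left, measure_preimage_add,
    Measure.addHaar_image_linearMap]

theorem ellipseArea_image (f : Plane ≃ᵃ[ℝ] Plane) (E : Set Plane) :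
    ellipseArea (f '' E) =
      ENNReal.ofReal |LinearMap.det (f.linear : Plane →ₗ[ℝ] Plane)| * ellipseArea E := by
  unfold ellipseArea
  rw [← volume_image_affineEquiv]
  congr 1
  exact (AffineMap.image_convexHull (f : Plane →ᵃ[ℝ] Plane) E).symm

theorem cross_image {f : Plane → Plane} {a b c d h k : ℝ} (hf : HasCoords f a b c d h k)
    (P Q X : Plane) : cross (f P) (f Q) (f X) = (a * d - b * c) * cross P Q X := by
  simp only [cross, (hf _).1, (hf _).2]
  ring

/-! ### Convex quadrilaterals as intersections of half-planes -/

/-- Positively oriented strictly convex quadrilaterals. -/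
def IsPositivelyConvex (R : Polygon Plane 4) : Prop :=
  ∀ i : Fin 4, 0 < cross (R i) (R (i + 1)) (R (i + 2)) ∧ 0 < cross (R i) (R (i + 1)) (R (i + 3))

/-- The barycentric coordinates of `X` are ratios of signed areas. -/
theorem mem_convexHull_of_cross_nonneg {P Q S X : Plane} (h : 0 < cross P Q S)
    (h1 : 0 ≤ cross P Q X) (h2 : 0 ≤ cross Q S X) (h3 : 0 ≤ cross S P X) {s : Set Plane}
    (hP : P ∈ s) (hQ : Q ∈ s) (hS : S ∈ s) : X ∈ convexHull ℝ s := by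
  have hc := convex_convexHull ℝ s
  have := hc.sum_mem (t := Finset.univ)
    (w := ![cross Q S X / cross P Q S, cross S P X / cross P Q S, cross P Q X / cross P Q S])
    (z := ![P, Q, S]) ?_ ?_ ?_
  · convert this
    apply plane_ext
    · simp [Fin.sum_univ_three]
      field_simp
      simp only [cross]
      ring
    · simp [Fin.sum_univ_three]
      field_simp
      simp only [cross]
      ring
  · intro i _
    fin_cases i
    · exact div_nonneg h2 h.le
    · exact div_nonneg h3 h.le
    · exact div_nonneg h1 h.le
  · simp [Fin.sum_univ_three]
    field_simp
    simp only [cross]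
    ring
  · intro i _
    fin_cases i
    · exact subset_convexHull ℝ s hP
    · exact subset_convexHull ℝ s hQ
    · exact subset_convexHull ℝ s hS

theorem convex_cross_nonneg (P Q : Plane) : Convex ℝ {X | 0 ≤ cross P Q X} := by
  intro X hX Y hY a b ha hb hab
  have : cross P Q (a • X + b • Y) = a * cross P Q X + b * cross P Q Y := by
    obtain rfl : b = 1 - a := by linarith
    simp [cross]
    ring
  simp only [Set.mem_ofPred_eq] at *
  rw [this]
  positivity

namespace IsPositivelyConvex

variable {R : Polygon Plane 4}

theorem mem_region_iff (hR : IsPositivelyConvex R) (X : Plane) :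
    X ∈ polygonRegion R ↔ ∀ i, 0 ≤ cross (R i) (R (i + 1)) X := by
  constructor
  · intro hX i
    refine convexHull_min ?_ (convex_cross_nonneg (R i) (R (i + 1))) hX
    rintro _ ⟨j, rfl⟩
    have : j = i ∨ j = i + 1 ∨ j = i + 2 ∨ j = i + 3 := by
      revert i j
      decide
    rcases this with rfl | rfl | rfl | rfl
    · exact (cross_self_left _ _).ge
    · exact (cross_self_right _ _).ge
    · exact (hR i).1.le
    · exact (hR i).2.le
  · intro h
    have m : ∀ i, R i ∈ Set.range R.vertices := fun i => ⟨i, rfl⟩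
    -- The diagonal from `R 1` to `R 3` cuts the region into two triangles.
    rcases le_total 0 (cross (R 1) (R 3) X) with h0 | h0
    · exact mem_convexHull_of_cross_nonneg (hR 0).2 (h 0) h0 (h 3) (m 0) (m 1) (m 3)
    · refine mem_convexHull_of_cross_nonneg (hR 1).1 (h 1) (h 2) ?_ (m 1) (m 2) (m 3)
      have : cross (R 3) (R 1) X = - cross (R 1) (R 3) X := by
        simp only [cross]
        ring
      rw [show (1 : Fin 4) + 2 = 3 from rfl, this]
      linarith

theorem ne (hR : IsPositivelyConvex R) (i : Fin 4) : R i ≠ R (i + 1) := by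
  intro h
  have := (hR i).1
  rw [← h] at this
  simp [cross] at this

theorem mem_edgeSet (hR : IsPositivelyConvex R) {i : Fin 4} {X : Plane}
    (hX : ∀ j, 0 ≤ cross (R j) (R (j + 1)) X) (hi : cross (R i) (R (i + 1)) X = 0) :
    X ∈ R.edgeSet ℝ i := by
  obtain ⟨s, rfl⟩ := mem_affineSpan_pair_iff_exists_lineMap_eq.1 ((mem_line_iff (hR.ne i)).2 hi)
  have e1 : i + 1 + 3 = i := by
    clear * -
    revert i
    decide
  have e2 : i + 3 + 1 = i := by
    clear * -
    revert i
    decide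
  have e3 : i + 3 + 2 = i + 1 := by
    clear * -
    revert i
    decide
  have a1 := (hR (i + 1)).2
  have a2 := (hR (i + 3)).1
  have b1 := hX (i + 1)
  have b2 := hX (i + 3)
  rw [cross_lineMap, cross_self_left] at b1
  rw [cross_lineMap, e2, cross_self_right] at b2
  rw [e1] at a1
  rw [e2, e3] at a2
  -- The half-planes of the two neighboring sides bound `s` below by 0 and above by 1.
  refine ⟨s, ⟨?_, ?_⟩, ?_⟩
  · by_contra! hs
    nlinarith
  · by_contra! hs
    nlinarith
  · rw [finRotate_apply]

end IsPositivelyConvex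

/-! ### Tangency as an equation in center and shape matrix -/

/-- The ellipse with center `(h, k)` and shape matrix `!![α, β; β, γ]`. -/
def shapeConic (α β γ h k : ℝ) : Set Plane :=
  {x | γ * (x 0 - h) ^ 2 - 2 * β * (x 0 - h) * (x 1 - k) + α * (x 1 - k) ^ 2 = α * γ - β ^ 2}

theorem mem_unitCircle {v : Plane} : v ∈ Metric.sphere (0 : Plane) 1 ↔ v 0 ^ 2 + v 1 ^ 2 = 1 := by
  rw [mem_sphere_zero_iff_norm, EuclideanSpace.norm_eq, Real.sqrt_eq_one]
  simp

theorem HasCoords.image_sphere {f : Plane ≃ᵃ[ℝ] Plane} {a b c d h k : ℝ}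
    (hf : HasCoords f a b c d h k) :
    f '' Metric.sphere 0 1 =
      shapeConic (a ^ 2 + b ^ 2) (a * c + b * d) (c ^ 2 + d ^ 2) h k := by
  have key : ∀ v, f v ∈ shapeConic (a ^ 2 + b ^ 2) (a * c + b * d) (c ^ 2 + d ^ 2) h k ↔
      v ∈ Metric.sphere (0 : Plane) 1 := by
    intro v
    rw [mem_unitCircle, shapeConic, Set.mem_ofPred_eq, (hf v).1, (hf v).2,
      ← mul_right_inj' (b := v 0 ^ 2 + v 1 ^ 2) (pow_ne_zero 2 hf.det_ne_zero)]
    constructor <;> intro e <;> linear_combination e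
  ext x
  rw [← f.apply_symm_apply x, key, f.injective.mem_set_image]

/-- On the unit circle the functional `m + u · v` has minimum `m - |u|`, attained at `-u / |u|`;
touching zero without changing sign forces `m = |u|`. -/
theorem pos_and_sq_eq_of_tangent {m u0 u1 : ℝ} (hu : u0 ^ 2 + u1 ^ 2 ≠ 0)
    (h : ∀ v0 v1 : ℝ, v0 ^ 2 + v1 ^ 2 = 1 → 0 ≤ m + u0 * v0 + u1 * v1)
    (h' : ∃ v0 v1 : ℝ, v0 ^ 2 + v1 ^ 2 = 1 ∧ m + u0 * v0 + u1 * v1 = 0) :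
    0 < m ∧ m ^ 2 = u0 ^ 2 + u1 ^ 2 := by
  obtain ⟨v0, v1, hv, e⟩ := h'
  have hpos : 0 < u0 ^ 2 + u1 ^ 2 := lt_of_le_of_ne (by positivity) hu.symm
  set r := √(u0 ^ 2 + u1 ^ 2) with hr
  have hr0 : 0 < r := Real.sqrt_pos.2 hpos
  have hr2 : r ^ 2 = u0 ^ 2 + u1 ^ 2 := Real.sq_sqrt hpos.le
  have h1 := h (-u0 / r) (-u1 / r) (by field_simp; linarith)
  have h2 : m + u0 * (-u0 / r) + u1 * (-u1 / r) = m - r := by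
    field_simp
    linarith
  rw [h2] at h1
  refine ⟨by linarith, ?_⟩
  have h3 : m ^ 2 ≤ r ^ 2 := by
    have : m = -(u0 * v0 + u1 * v1) := by linarith
    have h4 : (u0 * v0 + u1 * v1) ^ 2 + (u0 * v1 - u1 * v0) ^ 2 = r ^ 2 := by
      rw [hr2]
      linear_combination (u0 ^ 2 + u1 ^ 2) * hv
    rw [this]
    nlinarith [sq_nonneg (u0 * v1 - u1 * v0)]
  nlinarith

theorem nonneg_of_sq_eq {m u0 u1 v0 v1 : ℝ} (hm : 0 < m) (h : m ^ 2 = u0 ^ 2 + u1 ^ 2)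
    (hv : v0 ^ 2 + v1 ^ 2 = 1) :
    0 ≤ m + u0 * v0 + u1 * v1 ∧
      (m + u0 * v0 + u1 * v1 = 0 ↔ v0 = -u0 / m ∧ v1 = -u1 / m) := by
  -- This is `|m v + u|² = 2m (m + u · v)`, valid for `|v| = |u / m| = 1`; it gives both the sign
  -- and the unique zero.
  have key : (m * v0 + u0) ^ 2 + (m * v1 + u1) ^ 2 = 2 * m * (m + u0 * v0 + u1 * v1) := by
    linear_combination m ^ 2 * hv - h
  refine ⟨?_, fun e => ?_, ?_⟩
  · have : 0 ≤ 2 * m * (m + u0 * v0 + u1 * v1) := by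
      rw [← key]
      positivity
    exact nonneg_of_mul_nonneg_right this (by positivity)
  · rw [e, mul_zero] at key
    rw [eq_div_iff hm.ne', eq_div_iff hm.ne']
    constructor <;> nlinarith [sq_nonneg (m * v0 + u0), sq_nonneg (m * v1 + u1)]
  · rintro ⟨rfl, rfl⟩
    field_simp
    linear_combination h

/-- The ellipse with center `C` and shape matrix `!![α, β; β, γ]` touches the line `PQ` and lies
on its positive side. -/
def TouchesLine (α β γ : ℝ) (C P Q : Plane) : Prop :=
  0 < cross P Q C ∧ cross P Q C ^ 2 =
    γ * (Q 0 - P 0) ^ 2 - 2 * β * (Q 0 - P 0) * (Q 1 - P 1) + α * (Q 1 - P 1) ^ 2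

theorem HasCoords.cross_apply {f : Plane → Plane} {a b c d h k : ℝ}
    (hf : HasCoords f a b c d h k) (P Q v : Plane) :
    cross P Q (f v) = cross P Q !₂[h, k] + (c * (Q 0 - P 0) - a * (Q 1 - P 1)) * v 0 +
      (d * (Q 0 - P 0) - b * (Q 1 - P 1)) * v 1 := by
  simp only [cross, (hf _).1, (hf _).2]
  simp
  ring

theorem touchesLine_iff_sq_add_sq (a b c d h k : ℝ) (P Q : Plane) :
    TouchesLine (a ^ 2 + b ^ 2) (a * c + b * d) (c ^ 2 + d ^ 2) !₂[h, k] P Q ↔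
      0 < cross P Q !₂[h, k] ∧ cross P Q !₂[h, k] ^ 2 =
        (c * (Q 0 - P 0) - a * (Q 1 - P 1)) ^ 2 + (d * (Q 0 - P 0) - b * (Q 1 - P 1)) ^ 2 := by
  rw [TouchesLine]
  refine and_congr_right fun _ => ?_
  constructor <;> intro e <;> linear_combination e

/-- Pulled back by `f`, each side becomes an affine functional on the unit circle. That the contact
point lies on the side, not merely on its line, follows from inclusion in the region. -/
theorem isInscribedEllipse_image_iff {R : Polygon Plane 4} (hR : IsPositivelyConvex R)
    {f : Plane ≃ᵃ[ℝ] Plane} {a b c d h k : ℝ} (hf : HasCoords f a b c d h k) :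
    IsInscribedEllipse (f '' Metric.sphere 0 1) R ↔ ∀ i,
      TouchesLine (a ^ 2 + b ^ 2) (a * c + b * d) (c ^ 2 + d ^ 2) !₂[h, k] (R i) (R (i + 1)) := by
  simp_rw [touchesLine_iff_sq_add_sq]
  constructor
  · intro hE i
    apply pos_and_sq_eq_of_tangent
    · intro h0
      have h1 : c * ((R (i + 1)) 0 - (R i) 0) - a * ((R (i + 1)) 1 - (R i) 1) = 0 := by nlinarith
      have h2 : d * ((R (i + 1)) 0 - (R i) 0) - b * ((R (i + 1)) 1 - (R i) 1) = 0 := by nlinarith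
      apply hR.ne i
      apply plane_ext
      · apply mul_left_cancel₀ hf.det_ne_zero
        linear_combination b * h1 - a * h2
      · apply mul_left_cancel₀ hf.det_ne_zero
        linear_combination d * h1 - c * h2
    · intro v0 v1 hv
      have hm : !₂[v0, v1] ∈ Metric.sphere (0 : Plane) 1 := mem_unitCircle.2 (by simpa using hv)
      have := (hR.mem_region_iff _).1 (hE.subset_region ⟨_, hm, rfl⟩) i
      simpa [hf.cross_apply] using this
    · obtain ⟨p, -, hp⟩ := hE.tangent i
      obtain ⟨⟨v, hv, rfl⟩, hl⟩ : p ∈ _ ∩ _ := hp.symm ▸ Set.mem_singleton p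
      refine ⟨v 0, v 1, mem_unitCircle.1 hv, ?_⟩
      rw [← hf.cross_apply]
      exact cross_eq_zero_of_mem_line hl
  · intro hT
    have hreg : ∀ v ∈ Metric.sphere (0 : Plane) 1, ∀ i, 0 ≤ cross (R i) (R (i + 1)) (f v) := by
      intro v hv i
      rw [hf.cross_apply]
      exact (nonneg_of_sq_eq (hT i).1 (hT i).2 (mem_unitCircle.1 hv)).1
    refine ⟨⟨f, rfl⟩, ?_, fun i => ?_⟩
    · rintro _ ⟨v, hv, rfl⟩
      exact (hR.mem_region_iff _).2 (hreg v hv)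
    · obtain ⟨hm, hsq⟩ := hT i
      set m := cross (R i) (R (i + 1)) !₂[h, k]
      set u0 := c * ((R (i + 1)) 0 - (R i) 0) - a * ((R (i + 1)) 1 - (R i) 1)
      set u1 := d * ((R (i + 1)) 0 - (R i) 0) - b * ((R (i + 1)) 1 - (R i) 1)
      have hw : !₂[-u0 / m, -u1 / m] ∈ Metric.sphere (0 : Plane) 1 := by
        rw [mem_unitCircle]
        simp
        field_simp
        exact hsq.symm
      have hiff : ∀ v ∈ Metric.sphere (0 : Plane) 1,
          (f v ∈ line[ℝ, R i, R (i + 1)] ↔ v = !₂[-u0 / m, -u1 / m]) := by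
        intro v hv
        rw [mem_line_iff (hR.ne i), hf.cross_apply,
          (nonneg_of_sq_eq hm hsq (mem_unitCircle.1 hv)).2]
        constructor
        · rintro ⟨e0, e1⟩
          exact plane_ext e0 e1
        · rintro rfl
          exact ⟨rfl, rfl⟩
      refine ⟨f !₂[-u0 / m, -u1 / m], ?_, ?_⟩
      · exact hR.mem_edgeSet (hreg _ hw) (cross_eq_zero_of_mem_line ((hiff _ hw).2 rfl))
      · ext x
        constructor
        · rintro ⟨⟨v, hv, rfl⟩, hl⟩
          rw [(hiff v hv).1 hl]
          rfl
        · rintro rfl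
          exact ⟨⟨_, hw, rfl⟩, (hiff _ hw).2 rfl⟩

/-! ### The one-parameter family inscribed in the normalized quadrilateral -/

/-- The quadrilateral with vertices `(0, 0)`, `(1, 0)`, `(p, q)`, `(0, 1)`. -/
def stdQuad (p q : ℝ) : Polygon Plane 4 :=
  ⟨![!₂[0, 0], !₂[1, 0], !₂[p, q], !₂[0, 1]]⟩

theorem isPositivelyConvex_stdQuad {p q : ℝ} (hp : 0 < p) (hq : 0 < q) (hpq : 1 < p + q) :
    IsPositivelyConvex (stdQuad p q) := by
  have e1 : (3 : Fin 4) + 2 = 1 := rfl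
  have e2 : (3 : Fin 4) + 3 = 2 := rfl
  have e3 : (2 : Fin 4) + 3 = 1 := rfl
  intro i
  fin_cases i <;> constructor <;> simp [stdQuad, cross, e1, e2, e3] <;> linarith

theorem forall_touchesLine_stdQuad_iff {p q α β γ h k : ℝ} :
    (∀ i, TouchesLine α β γ !₂[h, k] (stdQuad p q i) (stdQuad p q (i + 1))) ↔
      (0 < k ∧ k ^ 2 = γ) ∧
      (0 < (p - 1) * k - q * (h - 1) ∧ ((p - 1) * k - q * (h - 1)) ^ 2 =
        γ * (p - 1) ^ 2 - 2 * β * (p - 1) * q + α * q ^ 2) ∧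
      (0 < -p * (k - q) - (1 - q) * (h - p) ∧ (-p * (k - q) - (1 - q) * (h - p)) ^ 2 =
        γ * (-p) ^ 2 - 2 * β * (-p) * (1 - q) + α * (1 - q) ^ 2) ∧
      (0 < h ∧ h ^ 2 = α) := by
  rw [Fin.forall_fin_succ, Fin.forall_fin_succ, Fin.forall_fin_succ, Fin.forall_fin_one]
  simp [TouchesLine, stdQuad, cross]

/-- First coordinate of the center of the inscribed ellipse of `stdQuad p q` with parameter `t`;
the second one is `stdCenter q t`. -/
noncomputable def stdCenter (p t : ℝ) : ℝ := ((1 - t) * p + t) / 2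

/-- The inscribed ellipses of `stdQuad p q` are parametrized by `t ∈ (0, 1)`. -/
def stdInellipse (p q t : ℝ) : Set Plane :=
  shapeConic (stdCenter p t ^ 2) (stdCenter p t * stdCenter q t - t / 2) (stdCenter q t ^ 2)
    (stdCenter p t) (stdCenter q t)

/-- The determinant of the shape matrix of `stdInellipse p q t`. -/
noncomputable def stdDet (p q t : ℝ) : ℝ := t * (1 - t) * (p * q - t * ((1 - p) * (1 - q))) / 4

theorem stdDet_eq (p q t : ℝ) :
    stdDet p q t = stdCenter p t ^ 2 * stdCenter q t ^ 2 -
      (stdCenter p t * stdCenter q t - t / 2) ^ 2 := by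
  unfold stdDet stdCenter
  ring

section

variable {p q : ℝ}

theorem stdDet_factor_pos (hp : 0 < p) (hq : 0 < q) (hpq : 1 < p + q) {t : ℝ}
    (ht : t ∈ Set.Icc (0 : ℝ) 1) : 0 < p * q - t * ((1 - p) * (1 - q)) := by
  have e : p * q - t * ((1 - p) * (1 - q)) = (1 - t) * (p * q) + t * (p + q - 1) := by ring
  have h1 := mul_nonneg (sub_nonneg.2 ht.2) (mul_pos hp hq).le
  rw [e]
  rcases ht.1.eq_or_lt with rfl | h0
  · simpa using mul_pos hp hq
  · exact add_pos_of_nonneg_of_pos h1 (mul_pos h0 (sub_pos.2 hpq))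

theorem stdDet_pos (hp : 0 < p) (hq : 0 < q) (hpq : 1 < p + q) {t : ℝ}
    (ht : t ∈ Set.Ioo (0 : ℝ) 1) : 0 < stdDet p q t := by
  have := stdDet_factor_pos hp hq hpq (Set.Ioo_subset_Icc_self ht)
  have h1 := ht.1
  have h2 := sub_pos.2 ht.2
  unfold stdDet
  positivity

theorem touchesLine_of_mem_Ioo (hp : 0 < p) (hq : 0 < q) (hpq : 1 < p + q) {t : ℝ}
    (ht : t ∈ Set.Ioo (0 : ℝ) 1) (i : Fin 4) :
    TouchesLine (stdCenter p t ^ 2) (stdCenter p t * stdCenter q t - t / 2) (stdCenter q t ^ 2)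
      !₂[stdCenter p t, stdCenter q t] (stdQuad p q i) (stdQuad p q (i + 1)) := by
  revert i
  have h1 := ht.1
  have h2 := sub_pos.2 ht.2
  have h3 := mul_pos h2 hp
  have h4 := mul_pos h2 hq
  have h5 := mul_pos h1 hp
  have h6 := mul_pos h1 hq
  have h7 := mul_pos h1 (sub_pos.2 hpq)
  rw [forall_touchesLine_stdQuad_iff]
  unfold stdCenter
  refine ⟨⟨by positivity, rfl⟩, ⟨by nlinarith, by ring⟩, ⟨by nlinarith, by ring⟩,
    ⟨by positivity, rfl⟩⟩

/-- A positive determinant alone does not exclude `t > 1`, since the third factor can change sign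
too. In that case `p * q ≤ t (1 - p) (1 - q) ≤ t² (1 - p) (1 - q)`, while multiplying two of the
four sign conditions gives `t² (1 - p) (1 - q) < p * q`. -/
theorem lt_one_of_stdDet_pos (hp : 0 < p) (hq : 0 < q) {t : ℝ} (ht0 : 0 < t)
    (hd : 0 < stdDet p q t) (g1 : t * (1 - p) < q) (g2 : t * (1 - q) < p)
    (g3 : t * (p - 1) < p) (g4 : t * (q - 1) < q) : t < 1 := by
  by_contra! h1t
  have hpq := mul_pos hp hq
  have hneg : p * q - t * ((1 - p) * (1 - q)) ≤ 0 := by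
    by_contra! h0
    have := mul_nonneg (mul_nonneg ht0.le (sub_nonneg.2 h1t)) h0.le
    unfold stdDet at hd
    linarith
  have hprod : 0 < (1 - p) * (1 - q) :=
    pos_of_mul_pos_right (show 0 < t * ((1 - p) * (1 - q)) by linarith) ht0.le
  have hlt : t ^ 2 * ((1 - p) * (1 - q)) < p * q := by
    rcases pos_and_pos_or_neg_and_neg_of_mul_pos hprod with ⟨a, b⟩ | ⟨a, b⟩
    · have := mul_lt_mul'' g1 g2 (mul_pos ht0 a).le (mul_pos ht0 b).le
      linarith
    · have := mul_lt_mul'' g3 g4 (mul_pos ht0 (by linarith)).le (mul_pos ht0 (by linarith)).le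
      linarith
  have := mul_nonneg (mul_nonneg ht0.le (sub_nonneg.2 h1t)) hprod.le
  linarith

theorem exists_param_of_touchesLine (hp : 0 < p) (hq : 0 < q) (hpq : 1 < p + q)
    {α β γ h k : ℝ} (hdet : 0 < α * γ - β ^ 2)
    (hT : ∀ i, TouchesLine α β γ !₂[h, k] (stdQuad p q i) (stdQuad p q (i + 1))) :
    ∃ t ∈ Set.Ioo (0 : ℝ) 1, h = stdCenter p t ∧ k = stdCenter q t ∧ α = stdCenter p t ^ 2 ∧
      γ = stdCenter q t ^ 2 ∧ β = stdCenter p t * stdCenter q t - t / 2 := by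
  rw [forall_touchesLine_stdQuad_iff] at hT
  obtain ⟨⟨hk, rfl⟩, ⟨h1, e1⟩, ⟨h2, e2⟩, ⟨hh, rfl⟩⟩ := hT
  obtain ⟨t, rfl⟩ : ∃ t, β = h * k - t / 2 := ⟨2 * (h * k - β), by ring⟩
  -- With `α = h²` and `γ = k²`, the other two tangency equations become linear in `h`, `k`, `t`
  -- after cancelling `q` and `p`; the resulting system for `(h, k)` is solvable because `p + q ≠
  -- 1`.
  have f1 : q - 2 * q * h + 2 * (p - 1) * (k - t / 2) = 0 := by
    apply mul_left_cancel₀ hq.ne'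
    linear_combination e1
  have f2 : p - 2 * p * k + 2 * (q - 1) * (h - t / 2) = 0 := by
    apply mul_left_cancel₀ hp.ne'
    linear_combination e2
  have hs : p + q - 1 ≠ 0 := by linarith
  have ch : h = stdCenter p t := by
    unfold stdCenter
    apply mul_left_cancel₀ hs
    linear_combination -(p / 2) * f1 - (p - 1) / 2 * f2
  have ck : k = stdCenter q t := by
    unfold stdCenter
    apply mul_left_cancel₀ hs
    linear_combination -(q / 2) * f2 - (q - 1) / 2 * f1
  refine ⟨t, ?_, ch, ck, by rw [ch], by rw [ck], by rw [ch, ck]⟩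
  have hd : 0 < t * (2 * h * k - t / 2) := by nlinarith
  have hhk := mul_pos hh hk
  have ht0 : 0 < t := by
    by_contra! h0
    exact hd.not_ge (mul_nonpos_of_nonpos_of_nonneg h0 (by linarith))
  refine ⟨ht0, ?_⟩
  have hd' : 0 < stdDet p q t := by
    rw [stdDet_eq, ← ch, ← ck]
    exact hdet
  unfold stdCenter at ch ck
  refine lt_one_of_stdDet_pos hp hq ht0 hd' ?_ ?_ ?_ ?_
  · rw [ch, ck] at h1
    linarith
  · rw [ch, ck] at h2
    linarith
  · linarith
  · linarith

theorem exists_eq_stdInellipse (hp : 0 < p) (hq : 0 < q) (hpq : 1 < p + q) {E : Set Plane}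
    (hE : IsInscribedEllipse E (stdQuad p q)) : ∃ t ∈ Set.Ioo (0 : ℝ) 1, E = stdInellipse p q t := by
  obtain ⟨f, rfl⟩ := hE.isEllipse
  obtain ⟨a, b, c, d, h, k, hf⟩ := exists_hasCoords f
  rw [isInscribedEllipse_image_iff (isPositivelyConvex_stdQuad hp hq hpq) hf] at hE
  have hdet : 0 < (a ^ 2 + b ^ 2) * (c ^ 2 + d ^ 2) - (a * c + b * d) ^ 2 := by
    have := pow_pos (abs_pos.2 hf.det_ne_zero) 2
    rw [sq_abs] at this
    linarith
  obtain ⟨t, ht, e1, e2, e3, e4, e5⟩ := exists_param_of_touchesLine hp hq hpq hdet hE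
  refine ⟨t, ht, ?_⟩
  rw [hf.image_sphere, e3, e4, e5, e1, e2, stdInellipse]

theorem exists_affineEquiv_stdInellipse (hp : 0 < p) (hq : 0 < q) (hpq : 1 < p + q) {t : ℝ}
    (ht : t ∈ Set.Ioo (0 : ℝ) 1) :
    ∃ f : Plane ≃ᵃ[ℝ] Plane, f '' Metric.sphere 0 1 = stdInellipse p q t ∧
      IsInscribedEllipse (f '' Metric.sphere 0 1) (stdQuad p q) ∧
      |LinearMap.det (f.linear : Plane →ₗ[ℝ] Plane)| = √(stdDet p q t) := by
  have hD := stdDet_pos hp hq hpq ht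
  have hT := touchesLine_of_mem_Ioo hp hq hpq ht
  obtain ⟨-, -, -, hh, -⟩ := forall_touchesLine_stdQuad_iff.1 hT
  have hDe := stdDet_eq p q t
  unfold stdInellipse
  set h := stdCenter p t
  set k := stdCenter q t
  have hs : √(stdDet p q t) ^ 2 = stdDet p q t := Real.sq_sqrt hD.le
  have hs0 : 0 < √(stdDet p q t) := Real.sqrt_pos.2 hD
  set s := √(stdDet p q t)
  have hsdet : h * (s / h) - 0 * ((h * k - t / 2) / h) = s := by
    field_simp
    ring
  -- The linear part is the lower triangular Cholesky factor of the shape matrix.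
  obtain ⟨f, hf⟩ := exists_affineEquiv_hasCoords (a := h) (b := 0) (c := (h * k - t / 2) / h)
    (d := s / h) h k (by rw [hsdet]; exact hs0.ne')
  have e1 : h ^ 2 + 0 ^ 2 = h ^ 2 := by ring
  have e2 : h * ((h * k - t / 2) / h) + 0 * (s / h) = h * k - t / 2 := by
    field_simp
    ring
  have e3 : ((h * k - t / 2) / h) ^ 2 + (s / h) ^ 2 = k ^ 2 := by
    rw [div_pow, div_pow, hs, hDe]
    field_simp
    ring
  refine ⟨f, ?_, ?_, ?_⟩
  · rw [hf.image_sphere, e1, e2, e3]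
  · rw [isInscribedEllipse_image_iff (isPositivelyConvex_stdQuad hp hq hpq) hf, e1, e2, e3]
    exact hT
  · rw [hf.det, hsdet, abs_of_pos hs0]

end

/-! ### Extrema of the determinant -/

section

variable {p q : ℝ}

theorem exists_forall_stdDet_le (hp : 0 < p) (hq : 0 < q) (hpq : 1 < p + q) :
    ∃ s ∈ Set.Ioo (0 : ℝ) 1, ∀ t ∈ Set.Ioo (0 : ℝ) 1, stdDet p q t ≤ stdDet p q s := by
  have hc : Continuous (stdDet p q) := by
    unfold stdDet
    fun_prop
  obtain ⟨s, hs, hmax⟩ := isCompact_Icc.exists_isMaxOn (Set.nonempty_Icc.2 zero_le_one)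
    (hc.continuousOn (s := Set.Icc (0 : ℝ) 1))
  refine ⟨s, ?_, fun t ht => hmax (Set.Ioo_subset_Icc_self ht)⟩
  have hhalf : (1 / 2 : ℝ) ∈ Set.Ioo (0 : ℝ) 1 := by norm_num
  have hpos : 0 < stdDet p q s :=
    (stdDet_pos hp hq hpq hhalf).trans_le (hmax (Set.Ioo_subset_Icc_self hhalf))
  constructor
  · refine lt_of_le_of_ne hs.1 ?_
    rintro rfl
    simp [stdDet] at hpos
  · refine lt_of_le_of_ne hs.2 ?_
    rintro rfl
    simp [stdDet] at hpos

/-- The determinant at the midpoint strictly exceeds the geometric mean. -/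
theorem stdDet_mul_stdDet_lt (hp : 0 < p) (hq : 0 < q) (hpq : 1 < p + q) {s t : ℝ}
    (hs : s ∈ Set.Ioo (0 : ℝ) 1) (ht : t ∈ Set.Ioo (0 : ℝ) 1) (hst : s ≠ t) :
    stdDet p q s * stdDet p q t < stdDet p q ((s + t) / 2) ^ 2 := by
  have hd : 0 < (s - t) ^ 2 := by
    have := sub_ne_zero.2 hst
    positivity
  have as := stdDet_factor_pos hp hq hpq (Set.Ioo_subset_Icc_self hs)
  have at' := stdDet_factor_pos hp hq hpq (Set.Ioo_subset_Icc_self ht)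
  have h1 : s * t < ((s + t) / 2) ^ 2 := by nlinarith
  have h2 : (1 - s) * (1 - t) < (1 - (s + t) / 2) ^ 2 := by nlinarith
  -- Only `≤` holds here: this factor is constant when `p = 1` or `q = 1`. Strictness comes from the
  -- other two factors.
  have h3 : (p * q - s * ((1 - p) * (1 - q))) * (p * q - t * ((1 - p) * (1 - q))) ≤
      (p * q - (s + t) / 2 * ((1 - p) * (1 - q))) ^ 2 := by
    nlinarith [mul_nonneg hd.le (sq_nonneg ((1 - p) * (1 - q)))]
  have s0 := hs.1
  have t0 := ht.1
  have s1 := sub_pos.2 hs.2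
  have t1 := sub_pos.2 ht.2
  have h12 : (s * t) * ((1 - s) * (1 - t)) < ((s + t) / 2) ^ 2 * (1 - (s + t) / 2) ^ 2 :=
    mul_lt_mul'' h1 h2 (by positivity) (by positivity)
  have h123 := mul_lt_mul h12 h3 (mul_pos as at') (by positivity)
  unfold stdDet
  linarith

theorem eq_of_forall_stdDet_le (hp : 0 < p) (hq : 0 < q) (hpq : 1 < p + q) {s t : ℝ}
    (hs : s ∈ Set.Ioo (0 : ℝ) 1) (ht : t ∈ Set.Ioo (0 : ℝ) 1)
    (hs' : ∀ r ∈ Set.Ioo (0 : ℝ) 1, stdDet p q r ≤ stdDet p q s)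
    (ht' : ∀ r ∈ Set.Ioo (0 : ℝ) 1, stdDet p q r ≤ stdDet p q t) : s = t := by
  by_contra hst
  have h := stdDet_mul_stdDet_lt hp hq hpq hs ht hst
  have hm : (s + t) / 2 ∈ Set.Ioo (0 : ℝ) 1 := by
    constructor <;> linarith [hs.1, hs.2, ht.1, ht.2]
  have h0 := stdDet_pos hp hq hpq hm
  nlinarith [hs' _ hm, ht' _ hm]

theorem exists_stdDet_lt (hp : 0 < p) (hq : 0 < q) (hpq : 1 < p + q) {s : ℝ}
    (hs : s ∈ Set.Ioo (0 : ℝ) 1) :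
    ∃ t ∈ Set.Ioo (0 : ℝ) 1, stdDet p q t < stdDet p q s := by
  have hc : Continuous (stdDet p q) := by
    unfold stdDet
    fun_prop
  have h0 : stdDet p q 0 < stdDet p q s := by
    simpa [stdDet] using stdDet_pos hp hq hpq hs
  have h1 : ∀ᶠ t in nhdsWithin (0 : ℝ) (Set.Ioi 0), stdDet p q t < stdDet p q s :=
    (hc.tendsto 0).eventually_lt_const h0 |>.filter_mono nhdsWithin_le_nhds
  obtain ⟨t, ht, ht'⟩ := (h1.and (Ioo_mem_nhdsGT zero_lt_one)).exists
  exact ⟨t, ht', ht⟩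

end

/-! ### Transport by affine maps and conclusion -/

/-- The image of a polygon under an affine equivalence. -/
noncomputable def mapPolygon (φ : Plane ≃ᵃ[ℝ] Plane) (R : Polygon Plane 4) : Polygon Plane 4 :=
  ⟨φ ∘ R.vertices⟩

theorem IsInscribedEllipse.image {E : Set Plane} {R : Polygon Plane 4}
    (hE : IsInscribedEllipse E R) (φ : Plane ≃ᵃ[ℝ] Plane) :
    IsInscribedEllipse (φ '' E) (mapPolygon φ R) := by
  obtain ⟨f, hf⟩ := hE.isEllipse
  refine ⟨⟨f.trans φ, ?_⟩, ?_, fun i => ?_⟩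
  · rw [hf, ← Set.image_comp]
    rfl
  · have := AffineMap.image_convexHull (φ : Plane →ᵃ[ℝ] Plane) (Set.range R.vertices)
    rw [← Set.range_comp] at this
    unfold polygonRegion mapPolygon
    refine (Set.image_mono hE.subset_region).trans ?_
    exact this.le
  · obtain ⟨x, hx, he⟩ := hE.tangent i
    have hseg : (mapPolygon φ R).edgeSet ℝ i = φ '' R.edgeSet ℝ i :=
      (affineSegment_image (φ : Plane →ᵃ[ℝ] Plane) _ _).symm
    have hline : (line[ℝ, mapPolygon φ R i, mapPolygon φ R (i + 1)] : Set Plane) =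
        φ '' (line[ℝ, R i, R (i + 1)] : Set Plane) := by
      have := AffineSubspace.map_span (φ : Plane →ᵃ[ℝ] Plane) {R i, R (i + 1)}
      rw [Set.image_pair] at this
      exact (congrArg (fun s : AffineSubspace ℝ Plane => (s : Set Plane)) this).symm
    refine ⟨φ x, hseg ▸ Set.mem_image_of_mem _ hx, ?_⟩
    rw [hline, ← Set.image_inter φ.injective, he, Set.image_singleton]

theorem isInscribedEllipse_mapPolygon_iff {E : Set Plane} {R : Polygon Plane 4}
    (φ : Plane ≃ᵃ[ℝ] Plane) :
    IsInscribedEllipse E (mapPolygon φ R) ↔ ∃ E₀, IsInscribedEllipse E₀ R ∧ E = φ '' E₀ := by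
  constructor
  · intro h
    refine ⟨φ.symm '' E, ?_, ?_⟩
    · have hR : mapPolygon φ.symm (mapPolygon φ R) = R := by
        obtain ⟨v⟩ := R
        simp only [mapPolygon]
        congr 1
        ext1 i
        exact φ.symm_apply_apply _
      exact hR ▸ h.image φ.symm
    · rw [← Set.image_comp, ← AffineEquiv.coe_trans, AffineEquiv.symm_trans_self]
      simp
  · rintro ⟨E₀, h, rfl⟩
    exact h.image φ

theorem IsConvexQuadrilateral.exists_eq_mapPolygon {R : Polygon Plane 4}
    (hR : IsConvexQuadrilateral R) :
    ∃ (p q : ℝ) (φ : Plane ≃ᵃ[ℝ] Plane), 0 < p ∧ 0 < q ∧ 1 < p + q ∧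
      R = mapPolygon φ (stdQuad p q) := by
  have hne : ∀ i, R i ≠ R (i + 1) := by
    intro i h
    have h2 := (hR (i + 1)).2.2
    rw [show i + 1 + 3 = i by clear * -; revert i; decide, h] at h2
    exact h2 (left_mem_affineSpan_pair _ _ _)
  have c0 := cross_mul_cross_pos (hne 0) (hR 0)
  have c1 := cross_mul_cross_pos (hne 1) (hR 1)
  have c3 := cross_mul_cross_pos (hne 3) (hR 3)
  change 0 < cross (R 0) (R 1) (R 2) * cross (R 0) (R 1) (R 3) at c0
  change 0 < cross (R 1) (R 2) (R 3) * cross (R 1) (R 2) (R 0) at c1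
  change 0 < cross (R 3) (R 0) (R 1) * cross (R 3) (R 0) (R 2) at c3
  have hD : cross (R 0) (R 1) (R 3) ≠ 0 := right_ne_zero_of_mul c0.ne'
  have hdet : (R 1 0 - R 0 0) * (R 3 1 - R 0 1) - (R 3 0 - R 0 0) * (R 1 1 - R 0 1) =
      cross (R 0) (R 1) (R 3) := by
    unfold cross
    ring
  obtain ⟨φ, hφ⟩ := exists_affineEquiv_hasCoords (a := R 1 0 - R 0 0) (b := R 3 0 - R 0 0)
    (c := R 1 1 - R 0 1) (d := R 3 1 - R 0 1) (R 0 0) (R 0 1) (by rwa [hdet])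
  have h0 : φ !₂[0, 0] = R 0 := by
    apply plane_ext
    · simp [(hφ _).1]
    · simp [(hφ _).2]
  have h1 : φ !₂[1, 0] = R 1 := by
    apply plane_ext
    · simp [(hφ _).1]
    · simp [(hφ _).2]
  have h3 : φ !₂[0, 1] = R 3 := by
    apply plane_ext
    · simp [(hφ _).1]
    · simp [(hφ _).2]
  obtain ⟨p, q, h2⟩ : ∃ p q, φ !₂[p, q] = R 2 := by
    refine ⟨φ.symm (R 2) 0, φ.symm (R 2) 1, ?_⟩
    rw [← φ.eq_symm_apply]
    apply plane_ext <;> simp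
  rw [← h0, ← h1, ← h2, ← h3] at c0 c1 c3
  simp only [cross_image hφ, hdet] at c0 c1 c3
  have hD2 : 0 < cross (R 0) (R 1) (R 3) ^ 2 := by positivity
  -- The determinant of `φ` now appears squared, so its sign, that is the orientation of `R`, drops
  -- out.
  rw [mul_mul_mul_comm, ← sq] at c0 c1 c3
  have hq : 0 < q := by
    have := pos_of_mul_pos_right c0 hD2.le
    simpa [cross] using this
  have hp : 0 < p := by
    have := pos_of_mul_pos_right c3 hD2.le
    simpa [cross] using this
  have hpq : 0 < (p - 1 + q) * q := by
    have := pos_of_mul_pos_right c1 hD2.le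
    simpa [cross] using this
  refine ⟨p, q, φ, hp, hq, by linarith [pos_of_mul_pos_left hpq hq.le], ?_⟩
  obtain ⟨v⟩ := R
  congr 1
  ext1 i
  fin_cases i
  · exact h0.symm
  · exact h1.symm
  · exact h2.symm
  · exact h3.symm

theorem isInscribedEllipse_stdQuad_iff {p q : ℝ} (hp : 0 < p) (hq : 0 < q) (hpq : 1 < p + q)
    {E : Set Plane} : IsInscribedEllipse E (stdQuad p q) ↔
      ∃ t ∈ Set.Ioo (0 : ℝ) 1, E = stdInellipse p q t := by
  refine ⟨exists_eq_stdInellipse hp hq hpq, ?_⟩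
  rintro ⟨t, ht, rfl⟩
  obtain ⟨f, hf, hi, -⟩ := exists_affineEquiv_stdInellipse hp hq hpq ht
  exact hf ▸ hi

theorem ellipseArea_stdInellipse {p q : ℝ} (hp : 0 < p) (hq : 0 < q) (hpq : 1 < p + q) {t : ℝ}
    (ht : t ∈ Set.Ioo (0 : ℝ) 1) : ellipseArea (stdInellipse p q t) =
      ENNReal.ofReal √(stdDet p q t) * ellipseArea (Metric.sphere 0 1) := by
  obtain ⟨f, hf, -, hd⟩ := exists_affineEquiv_stdInellipse hp hq hpq ht
  rw [← hf, ellipseArea_image, hd]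

/-- Both bounds are needed to cancel this factor in `ENNReal`. -/
theorem ellipseArea_unitCircle :
    ellipseArea (Metric.sphere 0 1) ≠ 0 ∧ ellipseArea (Metric.sphere 0 1) ≠ ⊤ := by
  unfold ellipseArea
  rw [convexHull_sphere_eq_closedBall _ zero_le_one]
  exact ⟨(Metric.measure_closedBall_pos _ _ one_pos).ne', measure_closedBall_lt_top.ne⟩

theorem ellipseArea_image_stdInellipse_le_iff {p q : ℝ} (hp : 0 < p) (hq : 0 < q)
    (hpq : 1 < p + q) (φ : Plane ≃ᵃ[ℝ] Plane) {s t : ℝ} (hs : s ∈ Set.Ioo (0 : ℝ) 1)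
    (ht : t ∈ Set.Ioo (0 : ℝ) 1) :
    ellipseArea (φ '' stdInellipse p q s) ≤ ellipseArea (φ '' stdInellipse p q t) ↔
      stdDet p q s ≤ stdDet p q t := by
  have hφ : ENNReal.ofReal |LinearMap.det (φ.linear : Plane →ₗ[ℝ] Plane)| ≠ 0 := by
    rw [← pos_iff_ne_zero, ENNReal.ofReal_pos, abs_pos]
    exact (LinearEquiv.isUnit_det' φ.linear).ne_zero
  rw [ellipseArea_image, ellipseArea_image, ellipseArea_stdInellipse hp hq hpq hs,
    ellipseArea_stdInellipse hp hq hpq ht, ENNReal.mul_le_mul_iff_right hφ ENNReal.ofReal_ne_top,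
    ENNReal.mul_le_mul_iff_left ellipseArea_unitCircle.1 ellipseArea_unitCircle.2,
    ENNReal.ofReal_le_ofReal_iff (Real.sqrt_nonneg _),
    Real.sqrt_le_sqrt_iff (stdDet_pos hp hq hpq ht).le]

theorem theorem4 (R : Polygon Plane 4) (hR : IsConvexQuadrilateral R) :
    (∃! E : Set Plane, IsInscribedEllipse E R ∧
      ∀ E' : Set Plane, IsInscribedEllipse E' R → ellipseArea E' ≤ ellipseArea E) ∧
    ¬ ∃ E : Set Plane, IsInscribedEllipse E R ∧
      ∀ E' : Set Plane, IsInscribedEllipse E' R → ellipseArea E ≤ ellipseArea E' := by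
  obtain ⟨p, q, φ, hp, hq, hpq, rfl⟩ := hR.exists_eq_mapPolygon
  have hins : ∀ E, IsInscribedEllipse E (mapPolygon φ (stdQuad p q)) ↔
      ∃ t ∈ Set.Ioo (0 : ℝ) 1, E = φ '' stdInellipse p q t := by
    intro E
    rw [isInscribedEllipse_mapPolygon_iff]
    constructor
    · rintro ⟨E₀, h, rfl⟩
      obtain ⟨t, ht, rfl⟩ := (isInscribedEllipse_stdQuad_iff hp hq hpq).1 h
      exact ⟨t, ht, rfl⟩
    · rintro ⟨t, ht, rfl⟩
      exact ⟨_, (isInscribedEllipse_stdQuad_iff hp hq hpq).2 ⟨t, ht, rfl⟩, rfl⟩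
  constructor
  · obtain ⟨s, hs, hmax⟩ := exists_forall_stdDet_le hp hq hpq
    refine ⟨φ '' stdInellipse p q s, ⟨(hins _).2 ⟨s, hs, rfl⟩, ?_⟩, ?_⟩
    · intro E' hE'
      obtain ⟨t, ht, rfl⟩ := (hins _).1 hE'
      exact (ellipseArea_image_stdInellipse_le_iff hp hq hpq φ ht hs).2 (hmax t ht)
    · rintro E ⟨hE, hE'⟩
      obtain ⟨t, ht, rfl⟩ := (hins _).1 hE
      rw [eq_of_forall_stdDet_le hp hq hpq ht hs (fun r hr => ?_) hmax]
      exact (ellipseArea_image_stdInellipse_le_iff hp hq hpq φ hr ht).1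
        (hE' _ ((hins _).2 ⟨r, hr, rfl⟩))
  · rintro ⟨E, hE, hmin⟩
    obtain ⟨s, hs, rfl⟩ := (hins _).1 hE
    obtain ⟨t, ht, hlt⟩ := exists_stdDet_lt hp hq hpq hs
    exact hlt.not_ge ((ellipseArea_image_stdInellipse_le_iff hp hq hpq φ hs ht).1
      (hmin _ ((hins _).2 ⟨t, ht, rfl⟩)))
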